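/- Ostaszewski's principle $\clubsuit$ is the statement that there are sets $S_\alpha\subseteq\alpha$, for $\alpha<\omega_1$ a (nonzero) limit ordinal, such that each $S_\alpha$ converges to $\alpha$ in the order topology (that is, $S_\alpha$ is infinite and every neighbourhood of $\alpha$ contains all but finitely many elements of $S_\alpha$), and such that every uncountable $X\subseteq\omega_1$ satisfies $S_\alpha\subseteq X$ for some limit ordinal $\alpha<\omega_1$. Given a partition $F_1,\dots,F_k$ of $\{1,\dots,m\}$, a point $(x_1,\dots,x_m)\in K^m$ is $(F_1,\dots,F_k)$-diverse if $\{x_j:j\in F_i\}\cap\{x_j:j\notin F_i\}=\emptyset$ for all $i\le k$. A compact Hausdorff space $K$ is $n$-diverse if for every $m\in\mathbb N$ and every partition $F_1,\dots,F_k$ of $\{1,\dots,m\}$ with $k\le n$, every sequence $(x^\alpha)_{\alpha<\omega_1}$ of $(F_1,\dots,F_k)$-diverse points of $K^m$ has an $(F_1,\dots,F_k)$-diverse cluster point, that is, an $(F_1,\dots,F_k)$-diverse point $z\in K^m$ each of whose neighbourhoods contains $x^\alpha$ for infinitely many $\alpha$. The height of a scattered space is the least ordinal $\alpha$ for which its $\alpha$-th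 Cantor--Bendixson derivative is empty. The weight of a space is the least cardinality of a base. **Proposition.** Assume $\clubsuit$. There is a non-separable compact scattered Hausdorff topology $\tau$ on $[0,\omega_1]$, of height $\omega+1$ and weight $\omega_1$, such that 1. $([0,\omega_1],\tau)$ is $n$-diverse for every $n\in\mathbb N$; 2. for every $\alpha<\omega_1$ there is $n\in\mathbb N$ (possibly $0$) such that $[0,\alpha+n]\cup\{\omega_1\}$ is $\tau$-closed; 3. there is a finite-to-one surjection $\phi:[0,\omega_1)\to[0,\omega_1)$ that is continuous from the subspace topology induced by $\tau$ to the order topology. -/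

import Mathlib

open Set Topology
open scoped Ordinal Cardinal

/-- A set `S` of ordinals converges to `α` in the order topology: it is infinite and every
neighbourhood of `α` contains all but finitely many of its elements. -/
def ConvergesTo (S : Set Ordinal.{0}) (α : Ordinal.{0}) : Prop :=
  S.Infinite ∧ ∀ U ∈ 𝓝 α, (S \ U).Finite

/-- Ostaszewski's principle `♣`: there are sets `S α`, for `α` a countable limit ordinal, such that
`S α ⊆ α` converges to `α`, and every uncountable `X ⊆ ω₁` contains some `S α`. (The values `S α`
at other ordinals `α` are irrelevant.) -/
def OstaszewskiClub : Prop :=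
  ∃ S : Ordinal.{0} → Set Ordinal.{0},
    (∀ α < ω₁, Order.IsSuccLimit α → S α ⊆ Iio α ∧ ConvergesTo (S α) α) ∧
    ∀ X : Set Ordinal.{0}, X ⊆ Iio ω₁ → ¬ X.Countable →
      ∃ α < ω₁, Order.IsSuccLimit α ∧ S α ⊆ X

/-- A space is scattered if each nonempty subset has a relatively isolated point. -/
def IsScattered (K : Type*) [TopologicalSpace K] : Prop :=
  ∀ A : Set K, A.Nonempty → ∃ x ∈ A, ∃ U : Set K, IsOpen U ∧ U ∩ A = {x}

/-- The Cantor-Bendixson height of a scattered space: the least ordinal `α` for which the `α`-th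
iterated derived set of the space is empty. -/
noncomputable def scatteredHeight (K : Type*) [TopologicalSpace K] : Ordinal :=
  sInf {α | CantorBendixson.iteratedDerivedSet (univ : Set K) α = ∅}

/-- The weight of a space: the least cardinality of a base. -/
noncomputable def topWeight (K : Type*) [TopologicalSpace K] : Cardinal :=
  sInf {κ | ∃ B : Set (Set K), TopologicalSpace.IsTopologicalBasis B ∧ #B = κ}

/-- A point of `K ^ m` is diverse with respect to a partition `F` of the set of coordinates if for
each part `P` no value on `P` is a value off `P`. -/
def IsDiversePoint {K : Type*} {m : ℕ} (F : Finpartition (Finset.univ : Finset (Fin m)))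
    (x : Fin m → K) : Prop :=
  ∀ P ∈ F.parts, {y | ∃ j ∈ P, x j = y} ∩ {y | ∃ j ∉ P, x j = y} = ∅

/-- `z` is a cluster (accumulation) point of an `ω₁`-sequence: every neighbourhood of `z` contains
the terms with infinitely many indices. -/
def IsClusterPoint {Y : Type*} [TopologicalSpace Y] (x : Iio (ω₁ : Ordinal.{0}) → Y) (z : Y) :
    Prop :=
  ∀ U ∈ 𝓝 z, {α | x α ∈ U}.Infinite

/-- `K` is `n`-diverse: for each partition of the coordinates of `K ^ m` into at most `n` parts,
each `ω₁`-sequence of diverse points of `K ^ m` has a diverse cluster point. -/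
def IsDiverse (K : Type*) [TopologicalSpace K] (n : ℕ) : Prop :=
  ∀ (m : ℕ) (F : Finpartition (Finset.univ : Finset (Fin m))), F.parts.card ≤ n →
    ∀ x : Iio (ω₁ : Ordinal.{0}) → Fin m → K, (∀ α, IsDiversePoint F (x α)) →
      ∃ z : Fin m → K, IsDiversePoint F z ∧ IsClusterPoint x z

/-! The space is the one-point compactification, by the point `ω₁`, of a locally compact topology on
the countable ordinals given by ladders: `C p` converges to `p`, and the neighbourhood `V p` joins
to `p` the neighbourhoods of its rungs. Each of these is first trimmed to the points of rank above
every earlier rung at the level of `p`. The trimming makes points of equal rank separable and the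
rank map continuous, and it keeps each `V p` compact and open.

The ladders come from `♣`, applied to ordinals coding pairs of a number `n` and a finite set of
ordinals with labels below `n`. When the guess at a limit `l` is coherent, the ordinals labelled `i`
form a ladder at `l + i`, for `i < n`. These ladders share one level, since `collapse` sends the
points `l + i` to `l`; `collapse` is the rank map and the finite-to-one map of the theorem. Rungs
whose rank bound exceeds `n` are discarded, so points have finite Cantor-Bendixson rank and the
height is `ω + 1`.

For diversity, pass to uncountably many indices on which some coordinates are constant and the
others countable-to-one. Label the latter by their part; diversity says exactly that no ordinal gets
two labels. `CapturesFamilies` yields infinitely many terms whose coordinates labelled `i` converge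
to `l + i`. Different parts thus have different limits, and `l` can be taken beyond the constant
coordinates. -/

/-! ### Ladder systems and their locally compact topology -/

/-- A ladder system: a rank map `φ` into a well-order and, for each point `p`, a set `C p` of
points of smaller rank which is to converge to `p`. -/
structure LadderSystem (L : Type*) (W : Type*) [LinearOrder W] [WellFoundedLT W] where
  /-- the rank map -/
  φ : L → W
  /-- the ladder at a point -/
  C : L → Set L
  φ_lt : ∀ {p x}, x ∈ C p → φ x < φ p
  disjoint_C : ∀ {p q}, φ p = φ q → p ≠ q → Disjoint (C p) (C q)
  finite_le : ∀ {μ γ}, γ < μ → {x | ∃ p, φ p = μ ∧ x ∈ C p ∧ φ x ≤ γ}.Finite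

namespace LadderSystem

variable {L W : Type*} [LinearOrder W] [WellFoundedLT W] (S : LadderSystem L W)

/-- `z` lies beyond all rungs at level `μ` whose rank is below that of `x`. -/
def Beyond (μ : W) (x z : L) : Prop :=
  ∀ p y, S.φ p = μ → y ∈ S.C p → S.φ y < S.φ x → S.φ y < S.φ z

/-- Membership in the basic neighbourhood of a point. -/
inductive Mem : L → L → Prop
  | refl (p : L) : Mem p p
  | step {p x z : L} : x ∈ S.C p → S.Beyond (S.φ p) x z → Mem z x → Mem z p

/-- The points of a ladder system, as a topological space. -/
def Pt (_ : LadderSystem L W) : Type _ := L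

/-- The basic neighbourhood of a point. -/
def V (p : S.Pt) : Set S.Pt := {z | S.Mem z p}

/-- The part of the basic neighbourhood of `p` that is contributed by the rung `x`. -/
def piece (p x : S.Pt) : Set S.Pt := {z | z ∈ S.V x ∧ S.Beyond (S.φ p) x z}

instance : TopologicalSpace S.Pt where
  IsOpen G := ∀ p ∈ G, {x : S.Pt | x ∈ S.C p ∧ ¬ S.piece p x ⊆ G}.Finite
  isOpen_univ := by simp
  isOpen_inter G H hG hH p hp := by
    refine ((hG p hp.1).union (hH p hp.2)).subset ?_
    rintro x ⟨hx, h⟩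
    by_contra hc
    simp only [mem_union, mem_ofPred_eq, not_or, not_and, not_not] at hc
    exact h (subset_inter (hc.1 hx) (hc.2 hx))
  isOpen_sUnion 𝒢 h𝒢 p hp := by
    obtain ⟨G, hG, hpG⟩ := hp
    refine (h𝒢 G hG p hpG).subset ?_
    rintro x ⟨hx, h⟩
    exact ⟨hx, fun hc => h (hc.trans (subset_sUnion_of_mem hG))⟩

variable {S}

theorem self_mem_V (p : S.Pt) : p ∈ S.V p := Mem.refl p

theorem self_mem_piece (p x : S.Pt) : x ∈ S.piece p x :=
  ⟨self_mem_V x, fun _ _ _ _ h => h⟩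

theorem piece_subset_V {p x : S.Pt} (hx : x ∈ S.C p) : S.piece p x ⊆ S.V p :=
  fun _ hz => Mem.step hx hz.2 hz.1

theorem mem_V_iff {p z : S.Pt} : z ∈ S.V p ↔ z = p ∨ ∃ x : S.Pt, x ∈ S.C p ∧ z ∈ S.piece p x := by
  constructor
  · intro h
    cases h with
    | refl => exact Or.inl rfl
    | step hx hb hm => exact Or.inr ⟨_, hx, hm, hb⟩
  · rintro (rfl | ⟨x, hx, hz⟩)
    · exact self_mem_V _
    · exact piece_subset_V hx hz

theorem φ_le_of_mem_V {p z : S.Pt} (h : z ∈ S.V p) : S.φ z ≤ S.φ p := by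
  induction h with
  | refl => exact le_rfl
  | step hx _ _ ih => exact ih.trans (S.φ_lt hx).le

theorem eq_or_φ_lt {p z : S.Pt} (h : z ∈ S.V p) : z = p ∨ S.φ z < S.φ p := by
  rcases mem_V_iff.1 h with rfl | ⟨x, hx, hz⟩
  · exact Or.inl rfl
  · exact Or.inr ((φ_le_of_mem_V hz.1).trans_lt (S.φ_lt hx))

/-- By induction on rank: if a common point lies in pieces of rungs `x` and `y` with `φ x < φ y`,
trimming puts its rank above `φ x`, which is impossible inside `V x`. Rungs of equal rank are
distinct, as the ladders are disjoint, so induction applies. -/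
theorem V_disjoint {p q : S.Pt} (h : S.φ p = S.φ q) (hpq : p ≠ q) : Disjoint (S.V p) (S.V q) := by
  induction hμ : S.φ p using WellFoundedLT.induction generalizing p q with
  | ind μ ih =>
    rw [Set.disjoint_left]
    intro z hzp hzq
    rcases mem_V_iff.1 hzp with rfl | ⟨x, hx, hzx⟩
    · rcases eq_or_φ_lt hzq with rfl | h'
      · exact hpq rfl
      · exact h'.ne h
    rcases mem_V_iff.1 hzq with rfl | ⟨y, hy, hzy⟩
    · rcases eq_or_φ_lt hzp with rfl | h'
      · exact hpq rfl
      · exact h'.ne h.symm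
    have hxy : x ≠ y := fun e => Set.disjoint_left.1 (S.disjoint_C h hpq) hx (e ▸ hy)
    rcases lt_trichotomy (S.φ x) (S.φ y) with h' | h' | h'
    · exact (hzy.2 p x h hx h').not_ge (φ_le_of_mem_V hzx.1)
    · exact Set.disjoint_left.1 (ih _ (hμ ▸ S.φ_lt hx) h' hxy rfl) hzx.1 hzy.1
    · exact (hzx.2 q y h.symm hy h').not_ge (φ_le_of_mem_V hzy.1)

theorem isOpen_of_lower {G : Set S.Pt} (h : ∀ p ∈ G, S.V p ⊆ G) : IsOpen G := fun p hp => by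
  convert Set.finite_empty
  ext x
  simp only [mem_ofPred_eq, mem_empty_iff_false, iff_false, not_and, not_not]
  exact fun hx => (piece_subset_V hx).trans (h p hp)

theorem isOpen_φ_le (γ : W) : IsOpen {z : S.Pt | S.φ z ≤ γ} :=
  isOpen_of_lower fun _ hp _ hz => (φ_le_of_mem_V hz).trans hp

theorem isOpen_φ_lt (γ : W) : IsOpen {z : S.Pt | S.φ z < γ} :=
  isOpen_of_lower fun _ hp _ hz => (φ_le_of_mem_V hz).trans_lt hp

theorem isOpen_lt_φ (γ : W) : IsOpen {z : S.Pt | γ < S.φ z} := by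
  intro q hq
  -- A rung `y` of rank at least `γ` at this level trims all later pieces to ranks above `γ`, and
  -- only finitely many rungs are not later. With no such `y`, all rungs have rank below `γ`, so the
  -- ladder is finite.
  by_cases hy : ∃ p y, S.φ p = S.φ q ∧ y ∈ S.C p ∧ γ ≤ S.φ y
  · obtain ⟨p, y, hp, hy, hγ⟩ := hy
    refine (S.finite_le (μ := S.φ q) (hp ▸ S.φ_lt hy)).subset ?_
    rintro x ⟨hx, h⟩
    refine ⟨q, rfl, hx, ?_⟩
    by_contra hc
    exact h fun z hz => hγ.trans_lt (hz.2 p y hp hy (not_le.1 hc))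
  · refine (S.finite_le (μ := S.φ q) hq).subset ?_
    rintro x ⟨hx, -⟩
    exact ⟨q, rfl, hx, not_lt.1 fun hc => hy ⟨q, x, rfl, hx, hc.le⟩⟩

theorem isClosed_lt_φ (γ : W) : IsClosed {z : S.Pt | γ < S.φ z} := by
  rw [← isOpen_compl_iff]
  convert isOpen_φ_le (S := S) γ using 1
  ext z; simp

theorem continuous_φ [TopologicalSpace W] [OrderTopology W] :
    Continuous (fun p : S.Pt => S.φ p) := by
  rw [OrderTopology.topology_eq_generate_intervals (α := W), continuous_generateFrom_iff]
  rintro s ⟨a, rfl | rfl⟩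
  · exact isOpen_lt_φ a
  · exact isOpen_φ_lt a

theorem isClosed_beyond (μ : W) (x : S.Pt) : IsClosed {z : S.Pt | S.Beyond μ x z} := by
  have : {z : S.Pt | S.Beyond μ x z} = ⋂ (p : S.Pt) (y : S.Pt) (_ : S.φ p = μ) (_ : y ∈ S.C p)
      (_ : S.φ y < S.φ x), {z : S.Pt | S.φ y < S.φ z} := by
    ext z; simp only [mem_ofPred_eq, mem_iInter]; rfl
  rw [this]
  exact isClosed_iInter fun p => isClosed_iInter fun y => isClosed_iInter fun _ =>
    isClosed_iInter fun _ => isClosed_iInter fun _ => isClosed_lt_φ _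

theorem isOpen_beyond {μ : W} {x : S.Pt} (hx : S.φ x < μ) :
    IsOpen {z : S.Pt | S.Beyond μ x z} := by
  have : {z : S.Pt | S.Beyond μ x z} = ⋂ y ∈ {y : S.Pt | (∃ p, S.φ p = μ ∧ y ∈ S.C p ∧
      S.φ y ≤ S.φ x) ∧ S.φ y < S.φ x}, {z : S.Pt | S.φ y < S.φ z} := by
    ext z
    simp only [mem_ofPred_eq, mem_iInter]
    exact ⟨fun h y hy => let ⟨⟨p, hp, hyp, _⟩, hlt⟩ := hy; h p y hp hyp hlt,
      fun h p y hp hy hlt => h y ⟨⟨p, hp, hy, hlt.le⟩, hlt⟩⟩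
  rw [this]
  exact ((S.finite_le hx).subset fun y hy => hy.1).isOpen_biInter fun y _ => isOpen_lt_φ _

theorem isOpen_V (p : S.Pt) : IsOpen (S.V p) := by
  induction hμ : S.φ p using WellFoundedLT.induction generalizing p with
  | ind μ ih =>
    have : S.V p = S.V p ∩ {p} ∪ ⋃ x ∈ S.C p, S.piece p x := by
      ext z
      simp only [mem_union, mem_inter_iff, mem_singleton_iff, mem_iUnion, exists_prop]
      refine ⟨fun h => (mem_V_iff.1 h).imp (fun e => ⟨h, e⟩) id, fun h => mem_V_iff.2 (h.imp
        (fun e => e.2) id)⟩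
    have hop : IsOpen (⋃ x ∈ S.C p, S.piece p x : Set S.Pt) :=
      isOpen_biUnion fun x hx =>
        (ih _ (hμ ▸ S.φ_lt hx) x rfl).inter (isOpen_beyond (S.φ_lt hx))
    intro q hq
    rcases mem_V_iff.1 hq with rfl | ⟨x, hx, hqx⟩
    · convert Set.finite_empty
      ext x
      simp only [mem_ofPred_eq, mem_empty_iff_false, iff_false, not_and, not_not]
      exact fun hx => piece_subset_V hx
    · refine (hop q (mem_biUnion hx hqx)).subset ?_
      rintro y ⟨hy, h⟩
      exact ⟨hy, fun hc => h (hc.trans (iUnion₂_subset fun x hx => piece_subset_V hx))⟩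

/-- A member of the cover containing `p` contains all but finitely many pieces, by the definition of
open sets; each remaining piece is closed in some `V x` of smaller rank. -/
theorem isCompact_V (p : S.Pt) : IsCompact (S.V p) := by
  induction hμ : S.φ p using WellFoundedLT.induction generalizing p with
  | ind μ ih =>
    refine isCompact_of_finite_subcover fun {ι} U hU hcov => ?_
    obtain ⟨i, hi⟩ := mem_iUnion.1 (hcov (self_mem_V p))
    have hfin := hU i p hi
    have hc : IsCompact (⋃ x ∈ {x : S.Pt | x ∈ S.C p ∧ ¬ S.piece p x ⊆ U i}, S.piece p x) :=
      hfin.isCompact_biUnion fun x hx =>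
        (ih _ (hμ ▸ S.φ_lt hx.1) x rfl).inter_right (isClosed_beyond _ _)
    obtain ⟨t, ht⟩ := hc.elim_finite_subcover U hU
      ((iUnion₂_subset fun x hx => piece_subset_V hx.1).trans hcov)
    classical
    refine ⟨insert i t, fun z hz => ?_⟩
    simp only [Finset.mem_insert, iUnion_iUnion_eq_or_left, mem_union]
    rcases mem_V_iff.1 hz with rfl | ⟨x, hx, hzx⟩
    · exact Or.inl hi
    · by_cases h : S.piece p x ⊆ U i
      · exact Or.inl (h hzx)
      · exact Or.inr (ht (mem_biUnion (show x ∈ {x : S.Pt | _} from ⟨hx, h⟩) hzx))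

instance : T2Space S.Pt := by
  refine ⟨fun p q hpq => ?_⟩
  rcases lt_trichotomy (S.φ p) (S.φ q) with h | h | h
  · exact ⟨_, _, isOpen_φ_le (S.φ p), isOpen_lt_φ (S.φ p), le_rfl, h,
      Set.disjoint_left.2 fun z (hz : _ ≤ _) (hz' : _ < _) => hz.not_gt hz'⟩
  · exact ⟨_, _, isOpen_V p, isOpen_V q, self_mem_V p, self_mem_V q, V_disjoint h hpq⟩
  · exact ⟨_, _, isOpen_lt_φ (S.φ q), isOpen_φ_le (S.φ q), h, le_rfl,
      Set.disjoint_left.2 fun z (hz : _ < _) (hz' : _ ≤ _) => hz'.not_gt hz⟩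

instance : LocallyCompactSpace S.Pt :=
  have : WeaklyLocallyCompactSpace S.Pt :=
    ⟨fun p => ⟨S.V p, isCompact_V p, (isOpen_V p).mem_nhds (self_mem_V p)⟩⟩
  inferInstance

/-- Each neighbourhood of `p` contains almost all rungs of the ladder at `p`. -/
theorem finite_C_diff {p : S.Pt} {U : Set S.Pt} (hU : U ∈ 𝓝 p) : {x | x ∈ S.C p ∧ x ∉ U}.Finite := by
  obtain ⟨G, hGU, hG, hp⟩ := mem_nhds_iff.1 hU
  exact (hG p hp).subset fun x hx => ⟨hx.1, fun h => hx.2 (hGU (h (self_mem_piece p x)))⟩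

end LadderSystem

/-! ### The one-point compactification: scatteredness, weight and height -/

/-- A topology on `K` under which `K` is a one-point compactification of `X`, for a given
identification of `X` with the complement of a point of `K`. -/
theorem exists_onePoint_topology {X K : Type*} [TopologicalSpace X] [LocallyCompactSpace X]
    [T2Space X] {i : X → K} (hi : Function.Injective i) {a : K} (hr : range i = {a}ᶜ) :
    ∃ τ : TopologicalSpace K, @T2Space K τ ∧ @CompactSpace K τ ∧ @IsOpenEmbedding X K _ τ i := by
  let g : OnePoint X → K := fun o => o.elim a i
  have ha : ∀ x, i x ≠ a := fun x => by
    have : i x ∈ ({a}ᶜ : Set K) := hr ▸ mem_range_self x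
    exact this
  have hg : Function.Bijective g := by
    constructor
    · intro x y
      induction x using OnePoint.rec <;> induction y using OnePoint.rec <;> intro h
      · rfl
      · exact absurd h.symm (ha _)
      · exact absurd h (ha _)
      · exact congrArg _ (hi h)
    · intro k
      by_cases hk : k = a
      · exact ⟨OnePoint.infty, hk.symm⟩
      · obtain ⟨x, rfl⟩ : k ∈ range i := hr ▸ hk
        exact ⟨(x : OnePoint X), rfl⟩
  let e : K ≃ OnePoint X := (Equiv.ofBijective g hg).symm
  let τ : TopologicalSpace K := TopologicalSpace.induced e inferInstance
  let h : K ≃ₜ OnePoint X := e.toHomeomorphOfIsInducing ⟨rfl⟩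
  refine ⟨τ, h.symm.t2Space, h.symm.compactSpace, ?_⟩
  exact h.symm.isOpenEmbedding.comp (OnePoint.isOpenEmbedding_coe (X := X))

namespace LadderSystem

variable {L W : Type*} [LinearOrder W] [WellFoundedLT W] {S : LadderSystem L W}
  {K : Type*} {i : S.Pt → K} {a : K}

theorem eq_or_mem_range (hr : range i = {a}ᶜ) (k : K) : k = a ∨ ∃ p, i p = k := by
  by_cases hk : k = a
  · exact Or.inl hk
  · exact Or.inr (show k ∈ range i from hr ▸ hk)

theorem exists_V_separating (hr : range i = {a}ᶜ) (hi : Function.Injective i) {x y : K}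
    (hxy : x ≠ y) : ∃ p, ¬ (x ∈ i '' S.V p ↔ y ∈ i '' S.V p) := by
  have ha : ∀ p, a ∉ i '' S.V p := by
    rintro p ⟨q, -, h⟩
    have : i q ∈ ({a}ᶜ : Set K) := hr ▸ mem_range_self q
    exact this h
  rcases eq_or_mem_range hr x with rfl | ⟨p, rfl⟩ <;> rcases eq_or_mem_range hr y with rfl | ⟨q, rfl⟩
  · exact absurd rfl hxy
  · exact ⟨q, fun h => ha q (h.2 (mem_image_of_mem _ (self_mem_V q)))⟩
  · exact ⟨p, fun h => ha p (h.1 (mem_image_of_mem _ (self_mem_V p)))⟩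
  · rcases le_total (S.φ p) (S.φ q) with h | h
    · refine ⟨p, fun h' => ?_⟩
      have := (hi.mem_set_image).1 (h'.1 (mem_image_of_mem _ (self_mem_V p)))
      rcases eq_or_φ_lt this with rfl | h''
      · exact hxy rfl
      · exact h''.not_ge h
    · refine ⟨q, fun h' => ?_⟩
      have := (hi.mem_set_image).1 (h'.2 (mem_image_of_mem _ (self_mem_V q)))
      rcases eq_or_φ_lt this with rfl | h''
      · exact hxy rfl
      · exact h''.not_ge h

variable [TopologicalSpace K]

/-- A point `p` of minimal rank in `A` is isolated in `A` by `V p`, whose other points have smaller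
rank. -/
theorem isScattered_onePoint (hi : IsOpenEmbedding i) (hr : range i = {a}ᶜ) : IsScattered K := by
  intro A hA
  by_cases hAi : (i ⁻¹' A).Nonempty
  · obtain ⟨p, hp, hmin⟩ := (InvImage.wf (fun p : S.Pt => S.φ p) wellFounded_lt).has_min _ hAi
    refine ⟨i p, hp, i '' S.V p, hi.isOpenMap _ (isOpen_V p), ?_⟩
    ext k
    constructor
    · rintro ⟨⟨q, hq, rfl⟩, hqA⟩
      rcases eq_or_φ_lt hq with rfl | h
      · rfl
      · exact absurd h (hmin q hqA)
    · rintro rfl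
      exact ⟨mem_image_of_mem _ (self_mem_V p), hp⟩
  · obtain ⟨k, hk⟩ := hA
    have key : ∀ k' ∈ A, k' = a := fun k' hk' => (eq_or_mem_range hr k').resolve_right
      fun ⟨p, hp⟩ => hAi ⟨p, show i p ∈ A from hp.symm ▸ hk'⟩
    refine ⟨k, hk, univ, isOpen_univ, ?_⟩
    rw [univ_inter]
    exact Subset.antisymm (fun k' hk' => (key k' hk').trans (key k hk).symm)
      (singleton_subset_iff.2 hk)

/-- A countable set has bounded rank, so it misses the open set of points of large rank. -/
theorem not_separableSpace_onePoint (hi : IsOpenEmbedding i)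
    (hS : ∀ s : Set S.Pt, s.Countable → ∃ p : S.Pt, ∀ q ∈ s, S.φ q < S.φ p) :
    ¬ TopologicalSpace.SeparableSpace K := by
  rintro ⟨D, hD, hdense⟩
  obtain ⟨p, hp⟩ := hS _ (hD.preimage hi.injective)
  obtain ⟨p', hp'⟩ := hS {p} (countable_singleton p)
  obtain ⟨k, ⟨q, hq, rfl⟩, hk⟩ := hdense.inter_open_nonempty _
    (hi.isOpenMap _ (isOpen_lt_φ (S := S) (S.φ p))) ⟨_, mem_image_of_mem i (hp' p rfl)⟩
  exact lt_asymm hq (hp q hk)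

/-- The topology of the one-point compactification is generated by the basic neighbourhoods and
their complements. -/
theorem eq_generateFrom_V [t2 : T2Space K] [CompactSpace K] (hi : IsOpenEmbedding i)
    (hr : range i = {a}ᶜ) : ‹TopologicalSpace K› = TopologicalSpace.generateFrom
      (range (fun p => i '' S.V p) ∪ range fun p => (i '' S.V p)ᶜ) := by
  set B : Set (Set K) := range (fun p => i '' S.V p) ∪ range fun p => (i '' S.V p)ᶜ
  have hle : ‹TopologicalSpace K› ≤ TopologicalSpace.generateFrom B := by
    refine le_generateFrom ?_
    rintro _ (⟨p, rfl⟩ | ⟨p, rfl⟩)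
    · exact hi.isOpenMap _ (isOpen_V p)
    · exact ((isCompact_V p).image hi.continuous).isClosed.isOpen_compl
  have h2 : @T2Space K (TopologicalSpace.generateFrom B) := by
    refine @T2Space.mk K (_) fun x y hxy => ?_
    obtain ⟨p, hp⟩ := exists_V_separating hr hi.injective hxy
    have o1 : IsOpen[TopologicalSpace.generateFrom B] (i '' S.V p) :=
      TopologicalSpace.isOpen_generateFrom_of_mem (Or.inl ⟨p, rfl⟩)
    have o2 : IsOpen[TopologicalSpace.generateFrom B] (i '' S.V p)ᶜ :=
      TopologicalSpace.isOpen_generateFrom_of_mem (Or.inr ⟨p, rfl⟩)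
    by_cases hx : x ∈ i '' S.V p
    · exact ⟨_, _, o1, o2, hx, fun hy => hp ⟨fun _ => hy, fun _ => hx⟩, disjoint_compl_right⟩
    · refine ⟨_, _, o2, o1, hx, ?_, disjoint_compl_left⟩
      by_contra hy
      exact hp ⟨fun h => absurd h hx, fun h => absurd h hy⟩
  -- A compact topology is never strictly finer than a Hausdorff one: closed sets are compact, hence
  -- compact and so closed in the coarser topology.
  refine le_antisymm hle fun U hU => ?_
  have hc : IsCompact Uᶜ := hU.isClosed_compl.isCompact
  have hc' : @IsCompact K (TopologicalSpace.generateFrom B) Uᶜ := by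
    have := @IsCompact.image K K _ (TopologicalSpace.generateFrom B) _ _ hc
      (continuous_id_of_le hle)
    rwa [image_id] at this
  rw [← @isClosed_compl_iff _ (TopologicalSpace.generateFrom B)]
  exact @IsCompact.isClosed K (TopologicalSpace.generateFrom B) h2 _ hc'

end LadderSystem

theorem topWeight_onePoint.{u, v} {L K : Type u} {W : Type v} [LinearOrder W] [WellFoundedLT W]
    {S : LadderSystem L W} [TopologicalSpace K] {i : S.Pt → K} {a : K}
    [T2Space K] [CompactSpace K] (hi : IsOpenEmbedding i)
    (hr : range i = {a}ᶜ) (hL : #L ≤ ℵ₁) (hsep : ¬ TopologicalSpace.SeparableSpace K) :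
    topWeight K = ℵ₁ := by
  have hne : {κ | ∃ B : Set (Set K), TopologicalSpace.IsTopologicalBasis B ∧ #B = κ}.Nonempty :=
    ⟨_, _, TopologicalSpace.isTopologicalBasis_opens, rfl⟩
  apply le_antisymm
  · set B : Set (Set K) := range (fun p => i '' S.V p) ∪ range fun p => (i '' S.V p)ᶜ
    have hB := TopologicalSpace.isTopologicalBasis_of_subbasis
      (LadderSystem.eq_generateFrom_V hi hr : _ = TopologicalSpace.generateFrom B)
    have hle : topWeight K ≤ _ := csInf_le' ⟨_, hB, rfl⟩
    refine hle.trans ?_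
    have hBc : #B ≤ ℵ₁ := by
      refine (Cardinal.mk_union_le _ _).trans ?_
      have h1 : #(range (fun p => i '' S.V p)) ≤ ℵ₁ := Cardinal.mk_range_le.trans hL
      have h2 : #(range fun p => (i '' S.V p)ᶜ) ≤ ℵ₁ := Cardinal.mk_range_le.trans hL
      exact (add_le_add h1 h2).trans (by simp)
    refine Cardinal.mk_image_le.trans ?_
    have : Function.Injective (fun f : {f : Set (Set K) | f.Finite ∧ f ⊆ B} =>
        (f.2.1.preimage (Subtype.val_injective.injOn) : (Subtype.val ⁻¹' f.1 : Set B).Finite).toFinset) := by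
      rintro ⟨f, hf, hfB⟩ ⟨g, hg, hgB⟩ h
      have h' : (Subtype.val ⁻¹' f : Set B) = Subtype.val ⁻¹' g := by
        simpa using h
      rw [Subtype.preimage_val_eq_preimage_val_iff, inter_eq_right.2 hfB, inter_eq_right.2 hgB] at h'
      exact Subtype.ext h'
    refine (Cardinal.mk_le_of_injective this).trans ?_
    rcases finite_or_infinite B with hf | hf
    · exact (Cardinal.lt_aleph0_of_finite _).le.trans Cardinal.aleph0_lt_aleph_one.le
    · rw [Cardinal.mk_finset_of_infinite]; exact hBc
  · refine le_csInf hne ?_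
    rintro κ ⟨B, hB, rfl⟩
    rw [Cardinal.aleph_one_le_iff, ← not_le, Cardinal.le_aleph0_iff_set_countable]
    intro hc
    have := hB.secondCountableTopology hc
    exact hsep inferInstance

open CantorBendixson in
-- The finite ranks `ρ` push every point but `a` out of some finite derivative. All finite
-- derivatives stay uncountable by `hlim`, and this keeps `a` in them.
theorem scatteredHeight_onePoint {L K W : Type*} [LinearOrder W] [WellFoundedLT W]
    {S : LadderSystem L W} [TopologicalSpace K] {i : S.Pt → K} {a : K}
    [T2Space K] [CompactSpace K] (hi : IsOpenEmbedding i) (hr : range i = {a}ᶜ)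
    (ρ : S.Pt → ℕ) (hρ : ∀ p x : S.Pt, x ∈ S.C p → ρ x < ρ p)
    (hV : ∀ p : S.Pt, (S.V p).Countable)
    (hu : ¬ (univ : Set S.Pt).Countable)
    (hlim : ∀ X : Set S.Pt, ¬ X.Countable → ¬ {p | AccPt p (Filter.principal X)}.Countable) :
    scatteredHeight K = ω + 1 := by
  have hρle : ∀ p z : S.Pt, z ∈ S.V p → ρ z ≤ ρ p := by
    intro p z h
    induction h with
    | refl => exact le_rfl
    | step hx _ _ ih => exact ih.trans (hρ _ _ hx).le
  have hρV : ∀ p z : S.Pt, z ∈ S.V p → z = p ∨ ρ z < ρ p := fun p z h =>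
    (LadderSystem.mem_V_iff.1 h).imp_right fun ⟨x, hx, hz⟩ => (hρle x z hz.1).trans_lt (hρ p x hx)
  set D : Ordinal → Set K := iteratedDerivedSet (univ : Set K)
  have hDc : ∀ b, IsClosed (D b) := isClosed_iteratedDerivedSet isClosed_univ
  have hDs : ∀ b, D (b + 1) = derivedSet (D b) := fun b => by
    rw [← (hDc b).relDerivedSet_eq]; exact iteratedDerivedSet_succ
  have hD0 : D 0 = univ := iteratedDerivedSet_zero
  have hup : ∀ n : ℕ, ∀ p, i p ∈ D n → n ≤ ρ p := by
    intro n
    induction n with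
    | zero => simp
    | succ n ih =>
      intro p hp
      push_cast at hp
      rw [hDs, mem_derivedSet, accPt_iff_nhds] at hp
      obtain ⟨k, ⟨⟨q, hq, rfl⟩, hk⟩, hne⟩ := hp _
        ((hi.isOpenMap _ (LadderSystem.isOpen_V p)).mem_nhds
          (mem_image_of_mem i (LadderSystem.self_mem_V p)))
      rcases hρV p q hq with rfl | h
      · exact absurd rfl hne
      · exact (ih q hk).trans_lt h
  have hunc : ∀ n : ℕ, ¬ (i ⁻¹' D n).Countable := by
    intro n
    induction n with
    | zero => simpa [hD0] using hu
    | succ n ih =>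
      refine fun hc => hlim _ ih (hc.mono fun p hp => ?_)
      push_cast
      rw [mem_preimage, hDs, mem_derivedSet, accPt_iff_nhds]
      intro U hU
      rw [mem_ofPred_eq, accPt_iff_nhds] at hp
      obtain ⟨q, hq, hne⟩ := hp (i ⁻¹' U) (hi.continuous.continuousAt hU)
      exact ⟨i q, hq, fun h => hne (hi.injective h)⟩
  have hinf : ∀ n : ℕ, a ∈ D n := by
    intro n
    by_contra ha
    -- Without `a`, the compact set `D n` would be covered by finitely many countable sets `V p`.
    have hcov : D n ⊆ ⋃ p, i '' S.V p := fun k hk => by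
      rcases LadderSystem.eq_or_mem_range hr k with rfl | ⟨p, rfl⟩
      · exact absurd hk ha
      · exact mem_iUnion.2 ⟨p, mem_image_of_mem i (LadderSystem.self_mem_V p)⟩
    obtain ⟨t, ht⟩ := (hDc n).isCompact.elim_finite_subcover _
      (fun p => hi.isOpenMap _ (LadderSystem.isOpen_V p)) hcov
    refine hunc n (((t.countable_toSet.biUnion fun p _ => (hV p).image i).mono ht).preimage
      hi.injective)
  have hω : D ω = {a} := by
    have hlimω : D ω = ⋂ b : Set.Iio ω, D b := iteratedDerivedSet_limit Ordinal.isSuccLimit_omega0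
    rw [hlimω]
    ext k
    simp only [mem_iInter, mem_singleton_iff]
    constructor
    · intro h
      rcases LadderSystem.eq_or_mem_range hr k with rfl | ⟨p, rfl⟩
      · rfl
      · have := hup (ρ p + 1) p (h ⟨_, Ordinal.natCast_lt_omega0 _⟩)
        omega
    · rintro rfl ⟨b, hb⟩
      obtain ⟨n, rfl⟩ := Ordinal.lt_omega0.1 hb
      exact hinf n
  have hω1 : D (ω + 1) = ∅ := by
    rw [hDs, hω]
    ext k
    simp only [mem_derivedSet, mem_empty_iff_false, iff_false, accPt_iff_nhds]
    intro h
    by_cases hk : k = a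
    · obtain ⟨y, ⟨-, hy⟩, hne⟩ := h univ Filter.univ_mem
      exact hne (hy.trans hk.symm)
    · obtain ⟨y, ⟨hy1, hy⟩, -⟩ := h _ (isOpen_compl_singleton.mem_nhds hk)
      exact hy1 hy
  refine le_antisymm (csInf_le' hω1) (le_csInf ⟨_, hω1⟩ fun b hb => ?_)
  by_contra hlt
  rw [not_le, Order.lt_add_one_iff] at hlt
  have hω' : a ∈ D ω := by rw [hω]; exact mem_singleton a
  have : a ∈ D b := iteratedDerivedSet_antitone univ hlt hω'
  exact (show a ∈ (∅ : Set K) from (hb : D b = ∅) ▸ this)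

/-! ### Countable ordinals: separated families and coding -/

/-- The countable ordinals. -/
abbrev Omega1 : Type 1 := Iio (ω₁ : Ordinal.{0})

namespace Omega1

theorem isSuccLimit_omega_one : Order.IsSuccLimit (ω₁ : Ordinal.{0}) := by
  rw [← Cardinal.ord_aleph]
  exact Cardinal.isSuccLimit_ord Cardinal.aleph0_lt_aleph_one.le

theorem exists_gt_of_countable {s : Set Omega1} (hs : s.Countable) : ∃ γ : Omega1, ∀ x ∈ s, x < γ := by
  have := hs.to_subtype
  have h : ⨆ x : s, Order.succ x.1.1 < ω₁ :=
    Ordinal.iSup_lt_omega_one fun x => Omega1.isSuccLimit_omega_one.succ_lt x.1.2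
  exact ⟨⟨_, h⟩, fun x hx => Subtype.mk_lt_mk.2 ((Order.lt_succ x.1).trans_le
    (Ordinal.le_iSup (fun x : s => Order.succ x.1.1) ⟨x, hx⟩))⟩

theorem mk_eq : #Omega1 = ℵ₁ := by
  rw [Omega1, Cardinal.mk_Iio_ordinal]; simp

theorem countable_Iic (γ : Omega1) : (Iic γ).Countable := by
  have h : (Iio (Order.succ γ.1)).Countable := by
    have h1 : (Order.succ γ.1).card < ℵ₁ :=
      Cardinal.lt_omega_iff_card_lt.1 (isSuccLimit_omega_one.succ_lt γ.2)
    rw [← Cardinal.le_aleph0_iff_set_countable, Cardinal.mk_Iio_ordinal, Cardinal.lift_le_aleph0]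
    exact not_lt.1 fun h => h1.not_ge (Cardinal.aleph_one_le_iff.2 h)
  refine (h.preimage (f := fun x : Omega1 => x.1) Subtype.val_injective).mono fun x hx => ?_
  exact Order.lt_succ_iff.2 (show x.1 ≤ γ.1 from hx)

/-- A maximal separated subfamily cannot be countable, for then its blocks would be bounded and a
block above the bound could be added. -/
theorem exists_uncountable_separated {ι : Type*} {𝒜 : Set ι} {v : ι → Set Omega1}
    (hv : ∀ t, (v t).Countable) (hne : ∀ t ∈ 𝒜, (v t).Nonempty)
    (h : ∀ γ, ∃ t ∈ 𝒜, ∀ a ∈ v t, γ < a) :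
    ∃ ℬ ⊆ 𝒜, ¬ ℬ.Countable ∧ ∀ t ∈ ℬ, ∀ t' ∈ ℬ, t ≠ t' →
      (∀ a ∈ v t, ∀ b ∈ v t', a < b) ∨ ∀ a ∈ v t, ∀ b ∈ v t', b < a := by
  obtain ⟨ℬ, hℬ⟩ := zorn_subset {ℬ | ℬ ⊆ 𝒜 ∧ ∀ t ∈ ℬ, ∀ t' ∈ ℬ, t ≠ t' →
      (∀ a ∈ v t, ∀ b ∈ v t', a < b) ∨ ∀ a ∈ v t, ∀ b ∈ v t', b < a} (by
    intro c hc hch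
    refine ⟨⋃₀ c, ⟨sUnion_subset fun s hs => (hc hs).1, ?_⟩, fun s => subset_sUnion_of_mem⟩
    rintro t ⟨s, hs, ht⟩ t' ⟨s', hs', ht'⟩ hne
    rcases hch.total hs hs' with hss | hss
    · exact (hc hs').2 t (hss ht) t' ht' hne
    · exact (hc hs).2 t ht t' (hss ht') hne)
  refine ⟨ℬ, hℬ.1.1, fun hcount => ?_, hℬ.1.2⟩
  obtain ⟨γ, hγ⟩ := exists_gt_of_countable (hcount.biUnion fun t _ => hv t)
  obtain ⟨t, ht, hta⟩ := h γ
  have hlt : ∀ t' ∈ ℬ, ∀ a ∈ v t', ∀ b ∈ v t, a < b := fun t' ht' a ha b hb =>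
    (hγ a (mem_biUnion ht' ha)).trans (hta b hb)
  have hmem : t ∈ ℬ := by
    refine hℬ.2 (y := insert t ℬ) ⟨insert_subset ht hℬ.1.1, ?_⟩ (subset_insert _ _) (mem_insert _ _)
    rintro s (rfl | hs) s' (rfl | hs') hss
    · exact absurd rfl hss
    · exact Or.inr fun a ha b hb => hlt _ hs' b hb a ha
    · exact Or.inl fun a ha b hb => hlt _ hs a ha b hb
    · exact hℬ.1.2 s hs s' hs' hss
  obtain ⟨a, ha⟩ := hne t ht
  exact lt_irrefl a (hlt t hmem a ha a ha)

theorem exists_code : ∃ e : Finset (Omega1 × ℕ) × ℕ → Omega1, Function.Injective e := by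
  have hinf : Infinite Omega1 := by
    rw [← Cardinal.aleph0_le_mk_iff, mk_eq]
    exact Cardinal.aleph0_lt_aleph_one.le
  have h : #(Finset (Omega1 × ℕ) × ℕ) ≤ #Omega1 := by
    rw [Cardinal.mk_prod, Cardinal.mk_finset_of_infinite, Cardinal.mk_prod, mk_eq]
    simp
  exact ⟨_, ((Cardinal.le_def _ _).1 h).some.injective⟩

end Omega1

/-! ### Labelled ladders from `♣` -/

/-- A set `R` of labelled countable ordinals is a ladder at `l` if its labels are bounded by `n`,
each ordinal has at most one label, and the labelled ordinals are below `l` and do not accumulate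
below `l`. -/
structure IsLabelledLadder (l : Omega1) (n : ℕ) (R : Set (Omega1 × ℕ)) : Prop where
  lt : ∀ p ∈ R, p.1 < l
  label_lt : ∀ p ∈ R, p.2 < n
  label_unique : ∀ x i j, (x, i) ∈ R → (x, j) ∈ R → i = j
  finite_le : ∀ γ < l, {p | p ∈ R ∧ p.1 ≤ γ}.Finite
  isSuccLimit : R.Nonempty → Order.IsSuccLimit l.1

/-- The form of `♣` for finite labelled sets. -/
theorem OstaszewskiClub.exists_labelledLadder (hclub : OstaszewskiClub) :
    ∃ (R : Omega1 → Set (Omega1 × ℕ)) (N : Omega1 → ℕ),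
      (∀ l, IsLabelledLadder l (N l) (R l)) ∧
      ∀ (n : ℕ) (𝒜 : Set (Finset (Omega1 × ℕ))),
        (∀ t ∈ 𝒜, t.Nonempty ∧ (∀ p ∈ t, p.2 < n) ∧
          ∀ x i j, (x, i) ∈ t → (x, j) ∈ t → i = j) →
        (∀ γ : Omega1, ∃ t ∈ 𝒜, ∀ p ∈ t, γ < p.1) →
        ∃ l, N l = n ∧ ∃ ℬ ⊆ 𝒜, ℬ.Infinite ∧ (∀ t ∈ ℬ, ↑t ⊆ R l) ∧
          ∀ t ∈ ℬ, ∀ t' ∈ ℬ, t ≠ t' → ∀ p ∈ t, ∀ q ∈ t', p.1 ≠ q.1 := by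
  classical
  obtain ⟨S, hS, hSX⟩ := hclub
  obtain ⟨e, he⟩ := Omega1.exists_code
  let R₀ : Omega1 → Set (Omega1 × ℕ) := fun l => {p | ∃ t k, (e (t, k)).1 ∈ S l.1 ∧ p ∈ t}
  -- The second coordinate of the code lets the guess determine `n`. Incoherent guesses are replaced
  -- by the empty ladder.
  let Good : Omega1 → ℕ → Prop := fun l n =>
    (∀ t k, (e (t, k)).1 ∈ S l.1 → k = n) ∧ IsLabelledLadder l n (R₀ l)
  let N : Omega1 → ℕ := fun l => if h : ∃ n, Good l n then h.choose else 0
  let R : Omega1 → Set (Omega1 × ℕ) := fun l => if ∃ n, Good l n then R₀ l else ∅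
  refine ⟨R, N, fun l => ?_, fun n 𝒜 h𝒜 hunb => ?_⟩
  · by_cases h : ∃ n, Good l n
    · simp only [R, N, dif_pos h, if_pos h]
      exact h.choose_spec.2
    · simp only [R, N, dif_neg h, if_neg h]
      constructor <;> simp
  -- Including the code in the block of `t` orders the codes and the sets alike, so that convergence
  -- of the codes to `l` passes to the points of the sets.
  obtain ⟨ℬ, hℬ𝒜, hℬc, hsep⟩ := Omega1.exists_uncountable_separated (𝒜 := 𝒜)
    (v := fun t => insert (e (t, n)) (Prod.fst '' (t : Set (Omega1 × ℕ))))
    (fun t => (((t.finite_toSet.image _).insert _)).countable) (fun t _ => insert_nonempty _ _) (by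
      intro γ
      -- Only countably many sets have code at most `γ`; a nonempty set lying above all their points
      -- is not one of them.
      have hc : {t : Finset (Omega1 × ℕ) | e (t, n) ≤ γ}.Countable :=
        (Omega1.countable_Iic γ).preimage (f := fun t => e (t, n))
          fun t t' h => (Prod.mk.inj (he h)).1
      obtain ⟨δ, hδ⟩ := Omega1.exists_gt_of_countable
        (hc.biUnion fun t _ => (t.finite_toSet.image Prod.fst).countable)
      obtain ⟨t, ht, hlt⟩ := hunb (max γ δ)
      refine ⟨t, ht, ?_⟩
      rintro a (rfl | ⟨p, hp, rfl⟩)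
      · by_contra hle
        obtain ⟨p, hp⟩ := (h𝒜 t ht).1
        have h1 := hδ p.1 (mem_biUnion (show t ∈ {t | _} from not_lt.1 hle)
          (mem_image_of_mem _ hp))
        exact lt_asymm h1 ((le_max_right _ _).trans_lt (hlt p hp))
      · exact (le_max_left _ _).trans_lt (hlt p hp))
  have hinj : Function.Injective fun t => (e (t, n)).1 := fun t t' h =>
    (Prod.mk.inj (he (Subtype.ext h))).1
  obtain ⟨α, hα, hαl, hαS⟩ := hSX ((fun t => (e (t, n)).1) '' ℬ)
    (by rintro _ ⟨t, -, rfl⟩; exact (e (t, n)).2)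
    (fun hc => hℬc (by simpa [preimage_image_eq _ hinj] using hc.preimage hinj))
  obtain ⟨hSα, hSinf, hSnhds⟩ := hS α hα hαl
  set l : Omega1 := ⟨α, hα⟩
  have hSfin : ∀ γ < l, {s | s ∈ S α ∧ s ≤ γ.1}.Finite := fun γ hγ =>
    (hSnhds _ (Ioi_mem_nhds (show γ.1 < α from hγ))).subset fun s hs =>
      ⟨hs.1, fun h => (show γ.1 < s from h).not_ge hs.2⟩
  have hdec : ∀ t k, (e (t, k)).1 ∈ S l.1 → t ∈ ℬ ∧ k = n := by
    intro t k h
    obtain ⟨t', ht', h'⟩ := hαS h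
    obtain ⟨rfl, rfl⟩ := Prod.mk.inj (he (Subtype.ext h'))
    exact ⟨ht', rfl⟩
  have hlarge : ∀ γ < l, ∃ t ∈ ℬ, (e (t, n)).1 ∈ S l.1 ∧ γ < e (t, n) := by
    intro γ hγ
    obtain ⟨s, hs, hγs⟩ := (hSinf.sdiff (hSfin γ hγ)).nonempty
    obtain ⟨t, ht, rfl⟩ := hαS hs
    exact ⟨t, ht, hs, not_le.1 fun h => hγs ⟨hs, h⟩⟩
  have hsep' : ∀ t ∈ ℬ, ∀ t' ∈ ℬ, e (t, n) < e (t', n) → ∀ p ∈ t, p.1 < e (t', n) ∧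
      ∀ q ∈ t', p.1 < q.1 := by
    intro t ht t' ht' hlt p hp
    rcases hsep t ht t' ht' (fun h => hlt.ne (h ▸ rfl)) with h | h
    · exact ⟨h _ (Or.inr ⟨p, hp, rfl⟩) _ (Or.inl rfl),
        fun q hq => h _ (Or.inr ⟨p, hp, rfl⟩) _ (Or.inr ⟨q, hq, rfl⟩)⟩
    · exact absurd (h _ (Or.inl rfl) _ (Or.inl rfl)) hlt.not_gt
  have hdisj : ∀ t ∈ ℬ, ∀ t' ∈ ℬ, t ≠ t' → ∀ p ∈ t, ∀ q ∈ t', p.1 ≠ q.1 := by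
    intro t ht t' ht' hne p hp q hq
    rcases hsep t ht t' ht' hne with h | h
    · exact (h _ (Or.inr ⟨p, hp, rfl⟩) _ (Or.inr ⟨q, hq, rfl⟩)).ne
    · exact (h _ (Or.inr ⟨p, hp, rfl⟩) _ (Or.inr ⟨q, hq, rfl⟩)).ne'
  have hgood : Good l n := by
    refine ⟨fun t k h => (hdec t k h).2, ⟨?_, ?_, ?_, ?_, fun _ => hαl⟩⟩
    · rintro p ⟨t, k, ht, hp⟩
      obtain ⟨htℬ, rfl⟩ := hdec t k ht
      obtain ⟨t', ht', hS', hlt⟩ := hlarge (e (t, k)) (hSα ht)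
      exact (hsep' t htℬ t' ht' hlt p hp).1.trans (hSα hS')
    · rintro p ⟨t, k, ht, hp⟩
      obtain ⟨htℬ, rfl⟩ := hdec t k ht
      exact (h𝒜 t (hℬ𝒜 htℬ)).2.1 p hp
    · rintro x i j ⟨t, k, ht, hp⟩ ⟨t', k', ht', hp'⟩
      obtain ⟨htℬ, rfl⟩ := hdec t k ht
      obtain ⟨htℬ', -⟩ := hdec t' k' ht'
      by_cases h : t = t'
      · subst h
        exact (h𝒜 t (hℬ𝒜 htℬ)).2.2 x i j hp hp'
      · exact absurd rfl (hdisj t htℬ t' htℬ' h (x, i) hp (x, j) hp')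
    · intro γ hγ
      -- A set with code above that of `t₀` lies entirely above the code of `t₀`, hence above `γ`.
      obtain ⟨t₀, ht₀, hS₀, hlt₀⟩ := hlarge γ hγ
      have hfin : {t | (e (t, n)).1 ∈ S α ∧ (e (t, n)).1 ≤ (e (t₀, n)).1}.Finite :=
        (hSfin (e (t₀, n)) (hSα hS₀)).preimage hinj.injOn
      refine (hfin.biUnion fun t _ => t.finite_toSet).subset ?_
      rintro p ⟨⟨t, k, ht, hp⟩, hpγ⟩
      obtain ⟨htℬ, rfl⟩ := hdec t k ht
      refine mem_biUnion (show t ∈ {t | _} from ⟨ht, ?_⟩) hp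
      by_contra hc
      have := (hsep' t₀ ht₀ t htℬ (not_le.1 hc))
      by_cases h : t = t₀
      · subst h; exact hc le_rfl
      · rcases hsep t htℬ t₀ ht₀ h with h' | h'
        · exact hc (h' _ (Or.inl rfl) _ (Or.inl rfl)).le
        · exact (h' _ (Or.inr ⟨p, hp, rfl⟩) _ (Or.inl rfl)).not_ge (hpγ.trans hlt₀.le)
  have hex : ∃ n, Good l n := ⟨n, hgood⟩
  refine ⟨l, ?_, {t | t ∈ ℬ ∧ (e (t, n)).1 ∈ S α}, fun t ht => hℬ𝒜 ht.1, ?_, ?_,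
    fun t ht t' ht' => hdisj t ht.1 t' ht'.1⟩
  · simp only [N, dif_pos hex]
    obtain ⟨t, -, ht, -⟩ := hlarge ⟨0, Omega1.isSuccLimit_omega_one.bot_lt⟩ hαl.bot_lt
    exact (hex.choose_spec.1 t n ht).symm
  · refine Infinite.of_image (fun t => (e (t, n)).1) (hSinf.mono fun s hs => ?_)
    obtain ⟨t, ht, rfl⟩ := hαS hs
    exact ⟨t, ⟨ht, hs⟩, rfl⟩
  · intro t ht p hp
    simp only [R, if_pos hex]
    exact ⟨t, n, ht.2, hp⟩

/-! ### Limit and finite parts of countable ordinals -/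

namespace Omega1

/-- The ordinal `p + n`. -/
def add (p : Omega1) (n : ℕ) : Omega1 :=
  ⟨p.1 + n, by
    induction n with
    | zero => simp
    | succ n ih =>
      rw [Nat.cast_succ, ← add_assoc, ← Order.succ_eq_add_one]
      exact isSuccLimit_omega_one.succ_lt ih⟩

/-- The largest multiple of `ω` up to `p`. -/
noncomputable def lim (p : Omega1) : Omega1 :=
  ⟨ω * (p.1 / ω), (Ordinal.mul_div_le p.1 ω).trans_lt p.2⟩

/-- The finite part of `p`. -/
noncomputable def fin (p : Omega1) : ℕ :=
  (Ordinal.lt_omega0.1 (Ordinal.mod_lt p.1 Ordinal.omega0_ne_zero)).choose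

theorem natCast_fin (p : Omega1) : (fin p : Ordinal) = p.1 % ω :=
  (Ordinal.lt_omega0.1 (Ordinal.mod_lt p.1 Ordinal.omega0_ne_zero)).choose_spec.symm

theorem lim_add_fin (p : Omega1) : add (lim p) (fin p) = p := by
  apply Subtype.ext
  simp only [add, lim, natCast_fin, Ordinal.div_add_mod]

theorem add_add (p : Omega1) (m n : ℕ) : add (add p m) n = add p (m + n) :=
  Subtype.ext (by simp [add, add_assoc])

theorem add_zero (p : Omega1) : add p 0 = p := Subtype.ext (by simp [add])

theorem lim_lim_add (p : Omega1) (n : ℕ) : lim (add (lim p) n) = lim p := by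
  apply Subtype.ext
  simp only [add, lim]
  rw [Ordinal.mul_add_div _ Ordinal.omega0_ne_zero,
    Ordinal.div_eq_zero_of_lt (Ordinal.natCast_lt_omega0 n), _root_.add_zero]

theorem fin_lim_add (p : Omega1) (n : ℕ) : fin (add (lim p) n) = n := by
  have h := natCast_fin (add (lim p) n)
  simp only [add, lim, Ordinal.mul_add_mod_self,
    Ordinal.mod_eq_of_lt (Ordinal.natCast_lt_omega0 n)] at h
  exact_mod_cast h

theorem lim_add (p : Omega1) (n : ℕ) : lim (add p n) = lim p := by
  rw [← lim_add_fin p, add_add, lim_lim_add, lim_lim_add]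

theorem fin_add (p : Omega1) (n : ℕ) : fin (add p n) = fin p + n := by
  conv_lhs => rw [← lim_add_fin p, add_add, fin_lim_add]

theorem add_le_add_iff (p : Omega1) (m n : ℕ) : add p m ≤ add p n ↔ m ≤ n := by
  rw [← Subtype.coe_le_coe]; simp [add]

theorem lim_le (p : Omega1) : lim p ≤ p := Subtype.coe_le_coe.1 (Ordinal.mul_div_le p.1 ω)

theorem lim_mono {p q : Omega1} (h : p ≤ q) : lim p ≤ lim q :=
  Subtype.coe_le_coe.1 (mul_le_mul_right (Ordinal.div_le_left h ω) ω)

theorem lim_eq_of_isSuccLimit {p : Omega1} (h : Order.IsSuccLimit p.1) : lim p = p := by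
  obtain ⟨q, hq⟩ := Ordinal.isSuccPrelimit_iff_omega0_dvd.1 h.isSuccPrelimit
  exact Subtype.ext (by simp only [lim]; rw [hq, Ordinal.mul_div_cancel _ Ordinal.omega0_ne_zero])

theorem add_lt_of_isSuccLimit {p q : Omega1} (h : Order.IsSuccLimit q.1) (hpq : p < q) (n : ℕ) :
    add p n < q := by
  induction n with
  | zero => rwa [add_zero]
  | succ n ih =>
    have := h.succ_lt (show (add p n).1 < q.1 from ih)
    rw [← Subtype.coe_lt_coe]
    simp only [add]
    rwa [Nat.cast_succ, ← add_assoc, ← Order.succ_eq_add_one]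

theorem lt_of_lim_lt {p q : Omega1} (h : lim p < lim q) : p < q :=
  not_le.1 fun h' => h.not_ge (lim_mono h')

theorem le_iff_fin_le {p q : Omega1} (h : lim p = lim q) : p ≤ q ↔ fin p ≤ fin q := by
  rw [← lim_add_fin p, ← lim_add_fin q, h, add_le_add_iff, fin_lim_add, fin_lim_add]

end Omega1

open Omega1

/-! ### The ladder system of a labelled ladder -/

section LabelledSystem

variable {R : Omega1 → Set (Omega1 × ℕ)} {N : Omega1 → ℕ}

/-- Collapse the first `N l` points from each multiple `l` of `ω` on to `l`. -/
noncomputable def collapse (N : Omega1 → ℕ) (p : Omega1) : Omega1 := add (lim p) (fin p - N (lim p))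

theorem lim_collapse (p : Omega1) : lim (collapse N p) = lim p := lim_lim_add _ _

theorem fin_collapse (p : Omega1) : fin (collapse N p) = fin p - N (lim p) := fin_lim_add _ _

theorem collapse_le (p : Omega1) : collapse N p ≤ p := by
  rw [le_iff_fin_le (lim_collapse p), fin_collapse]; omega

theorem collapse_add (p : Omega1) : collapse N (add p (N (lim p))) = p := by
  rw [collapse, lim_add, fin_add, Nat.add_sub_cancel, lim_add_fin]

/-- The points of rank at most `γ` thus form an initial segment of `ω₁`. This gives the closed sets
of the theorem and the countability of each `V p`. -/
theorem collapse_le_iff (p γ : Omega1) : collapse N p ≤ γ ↔ p ≤ add γ (N (lim γ)) := by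
  rcases lt_trichotomy (lim p) (lim γ) with h | h | h
  · exact iff_of_true (lt_of_lim_lt (by rwa [lim_collapse])).le (lt_of_lim_lt (by rwa [lim_add])).le
  · rw [le_iff_fin_le (by rwa [lim_collapse]), le_iff_fin_le (by rwa [lim_add]), fin_add,
      fin_collapse, h]
    omega
  · exact iff_of_false (lt_of_lim_lt (by rwa [lim_collapse])).not_ge
      (lt_of_lim_lt (by rwa [lim_add])).not_ge

theorem finite_collapse_preimage (β : Omega1) : (collapse N ⁻¹' {β}).Finite := by
  refine ((Set.finite_Iic (fin β + N (lim β))).image (add (lim β))).subset fun x hx => ?_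
  have hx : collapse N x = β := hx
  subst hx
  refine ⟨fin x, ?_, by rw [lim_collapse, lim_add_fin]⟩
  rw [mem_Iic, fin_collapse, lim_collapse]
  omega

/-- A bound for the Cantor-Bendixson rank of a point. -/
noncomputable def rankBound (N : Omega1 → ℕ) (p : Omega1) : ℕ :=
  if fin p < N (lim p) then N (lim p) + 1 else 0

/-- The ladder system in which the point `l + i` is a limit of the ordinals labelled `i` in the
labelled ladder at `l`. -/
noncomputable def labelledSystem (hR : ∀ l, IsLabelledLadder l (N l) (R l)) :
    LadderSystem Omega1 Omega1 where
  φ := collapse N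
  C p := {x | (x, fin p) ∈ R (lim p) ∧ rankBound N x ≤ N (lim p)}
  φ_lt {p x} hx := by
    refine (collapse_le x).trans_lt (((hR _).lt _ hx.1).trans_le ?_)
    rw [← lim_collapse (N := N)]
    exact lim_le _
  disjoint_C {p q} h hpq := by
    rw [Set.disjoint_left]
    rintro x ⟨hx, -⟩ ⟨hx', -⟩
    have hl : lim p = lim q := by rw [← lim_collapse (N := N), h, lim_collapse]
    rw [hl] at hx
    exact hpq (by rw [← lim_add_fin p, ← lim_add_fin q, hl, (hR _).label_unique _ _ _ hx hx'])
  finite_le {μ γ} h := by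
    by_cases hne : (R μ).Nonempty
    · have hlim := (hR μ).isSuccLimit hne
      refine (((hR μ).finite_le (add γ (N (lim γ))) (add_lt_of_isSuccLimit hlim h _)).image
        Prod.fst).subset ?_
      rintro x ⟨p, hp, hx, hxγ⟩
      have hl : lim p = μ := by
        rw [← lim_collapse (N := N), hp, lim_eq_of_isSuccLimit hlim]
      exact ⟨(x, fin p), ⟨hl ▸ hx.1, (collapse_le_iff _ _).1 hxγ⟩, rfl⟩
    · convert Set.finite_empty
      rw [eq_empty_iff_forall_notMem]
      rintro x ⟨p, hp, hx, -⟩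
      have hlt := (hR _).label_lt _ hx.1
      have h0 : collapse N p = lim p := by
        rw [collapse, Nat.sub_eq_zero_of_le hlt.le, Omega1.add_zero]
      exact hne ⟨_, (h0.symm.trans hp) ▸ hx.1⟩

theorem rankBound_lt (hR : ∀ l, IsLabelledLadder l (N l) (R l)) {p x : Omega1}
    (hx : x ∈ (labelledSystem hR).C p) : rankBound N x < rankBound N p := by
  have h1 : fin p < N (lim p) := (hR _).label_lt _ hx.1
  rw [show rankBound N p = N (lim p) + 1 from if_pos h1]
  exact Nat.lt_succ_of_le hx.2

/-- The main property of the ladder systems obtained from `♣`. -/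
def CapturesFamilies (hR : ∀ l, IsLabelledLadder l (N l) (R l)) : Prop :=
  ∀ (n : ℕ) (𝒜 : Set (Finset (Omega1 × ℕ))),
    (∀ t ∈ 𝒜, t.Nonempty ∧ (∀ p ∈ t, p.2 < n ∧ rankBound N p.1 ≤ n) ∧
      ∀ x i j, (x, i) ∈ t → (x, j) ∈ t → i = j) →
    (∀ γ : Omega1, ∃ t ∈ 𝒜, ∀ p ∈ t, γ < p.1) →
    ∃ l, lim l = l ∧ ∃ ℬ ⊆ 𝒜, ℬ.Infinite ∧ (∀ t ∈ ℬ, t.Nonempty ∧ ∀ p ∈ t, p.1 < l) ∧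
      ∀ U : ℕ → Set (labelledSystem hR).Pt, (∀ i, U i ∈ @nhds (labelledSystem hR).Pt _ (add l i)) →
        {t | t ∈ ℬ ∧ ∃ p ∈ t, p.1 ∉ U p.2}.Finite

end LabelledSystem

/-- Only finitely many rungs of the finitely many ladders at the points `l + i` escape the given
neighbourhoods, and disjointness lets each spoil at most one set. The bound `n = N l` on ranks
ensures that no guessed point is discarded as a rung. -/
theorem OstaszewskiClub.exists_capturesFamilies (hclub : OstaszewskiClub) :
    ∃ (R : Omega1 → Set (Omega1 × ℕ)) (N : Omega1 → ℕ) (hR : ∀ l, IsLabelledLadder l (N l) (R l)),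
      CapturesFamilies hR := by
  obtain ⟨R, N, hR, hcl⟩ := hclub.exists_labelledLadder
  refine ⟨R, N, hR, fun n 𝒜 h𝒜 hunb => ?_⟩
  obtain ⟨l, rfl, ℬ, hℬ𝒜, hinf, hℬR, hdisj⟩ := hcl n 𝒜
    (fun t ht => ⟨(h𝒜 t ht).1, fun p hp => ((h𝒜 t ht).2.1 p hp).1, (h𝒜 t ht).2.2⟩) hunb
  have hlim : lim l = l := by
    obtain ⟨t, ht⟩ := hinf.nonempty
    obtain ⟨p, hp⟩ := (h𝒜 t (hℬ𝒜 ht)).1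
    exact lim_eq_of_isSuccLimit ((hR l).isSuccLimit ⟨p, hℬR t ht hp⟩)
  refine ⟨l, hlim, ℬ, hℬ𝒜, hinf, fun t ht => ⟨(h𝒜 t (hℬ𝒜 ht)).1,
    fun p hp => (hR l).lt p (hℬR t ht hp)⟩, fun U hU => ?_⟩
  have hbad : {p : Omega1 × ℕ | p.2 < N l ∧ p.1 ∈ (labelledSystem hR).C (add l p.2) ∧
      p.1 ∉ U p.2}.Finite := by
    refine ((Set.finite_Iio (N l)).biUnion fun i _ =>
      (LadderSystem.finite_C_diff (hU i)).image fun x => (x, i)).subset ?_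
    rintro ⟨x, i⟩ ⟨hi, hx⟩
    exact mem_biUnion (show i ∈ Iio (N l) from hi) ⟨x, hx, rfl⟩
  refine (hbad.biUnion (t := fun p => {t | t ∈ ℬ ∧ p ∈ t}) fun p _ => ?_).subset ?_
  · refine Set.Subsingleton.finite fun t ht t' ht' => ?_
    by_contra hne
    exact hdisj t ht.1 t' ht'.1 hne p ht.2 p ht'.2 rfl
  · rintro t ⟨ht, p, hp, hpU⟩
    have h2 := (h𝒜 t (hℬ𝒜 ht)).2.1 p hp
    refine mem_biUnion (show p ∈ {p : Omega1 × ℕ | _} from ⟨h2.1, ⟨?_, ?_⟩, hpU⟩) ⟨ht, hp⟩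
    · rw [← hlim, lim_lim_add, fin_lim_add, hlim]
      exact hℬR t ht hp
    · rw [← hlim, lim_lim_add, hlim]
      exact h2.2
open Omega1

/-! ### Accumulation points and diversity -/

theorem exists_uncountable_bounded {ι : Type*} {X : Set ι} (hX : ¬ X.Countable) (f : ι → ℕ) :
    ∃ n, ¬ {x | x ∈ X ∧ f x ≤ n}.Countable := by
  by_contra! h
  exact hX ((countable_iUnion h).mono fun x hx =>
    mem_iUnion.2 ⟨f x, show x ∈ {y | y ∈ X ∧ f y ≤ f x} from ⟨hx, le_rfl⟩⟩)

section CapturesFamilies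

variable {R : Omega1 → Set (Omega1 × ℕ)} {N : Omega1 → ℕ}
  {hR : ∀ l, IsLabelledLadder l (N l) (R l)}

theorem CapturesFamilies.uncountable_accPt (hcap : CapturesFamilies hR)
    {X : Set (labelledSystem hR).Pt} (hX : ¬ X.Countable) :
    ¬ {p | AccPt p (Filter.principal X)}.Countable := by
  intro hc
  obtain ⟨γ, hγ⟩ := exists_gt_of_countable hc
  obtain ⟨n, hn⟩ := exists_uncountable_bounded hX (rankBound N)
  -- Singletons labelled `0` are captured at `l` itself; `n + 1` leaves room for that label, and
  -- points above `γ` force `l > γ`.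
  obtain ⟨l, hl, ℬ, hℬ, hinf, hlt, hU⟩ := hcap (n + 1)
    {t | ∃ x : Omega1, x ∈ X ∧ rankBound N x ≤ n ∧ γ < x ∧ t = {(x, 0)}} (by
      rintro _ ⟨x, hx, hxn, -, rfl⟩
      refine ⟨Finset.singleton_nonempty _, ?_, ?_⟩
      · intro p hp
        rw [Finset.mem_singleton.1 hp]
        exact ⟨Nat.succ_pos n, hxn.trans n.le_succ⟩
      · intro y i j hi hj
        simp only [Finset.mem_singleton, Prod.mk.injEq] at hi hj
        omega) (by
      intro δ
      obtain ⟨x, ⟨hx, hxn⟩, hlt⟩ : ∃ x : Omega1, (x ∈ X ∧ rankBound N x ≤ n) ∧ max γ δ < x := by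
        by_contra! h
        exact hn ((countable_Iic (max γ δ)).mono fun x hx => h x hx)
      refine ⟨_, ⟨x, hx, hxn, (le_max_left _ _).trans_lt hlt, rfl⟩, fun p hp => ?_⟩
      rw [Finset.mem_singleton.1 hp]
      exact (le_max_right _ _).trans_lt hlt)
  have hacc : l ∈ {p : (labelledSystem hR).Pt | AccPt p (Filter.principal X)} := by
    refine (accPt_iff_nhds (X := (labelledSystem hR).Pt)).2 fun V hV => ?_
    have hfin := hU (fun i => if i = 0 then V else univ) fun i => by
      by_cases hi : i = 0
      · subst hi; simpa [Omega1.add_zero] using hV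
      · simp [hi]
    obtain ⟨t, ht, htV⟩ := (hinf.sdiff hfin).nonempty
    obtain ⟨x, hx, -, -, rfl⟩ := hℬ ht
    refine ⟨x, ⟨?_, hx⟩, ((hlt _ ht).2 _ (Finset.mem_singleton_self _)).ne⟩
    by_contra hxV
    exact htV ⟨ht, _, Finset.mem_singleton_self _, by rw [if_pos rfl]; exact hxV⟩
  obtain ⟨t, ht⟩ := hinf.nonempty
  obtain ⟨x, -, -, hx, rfl⟩ := hℬ ht
  exact lt_asymm (hγ l hacc) (hx.trans ((hlt _ ht).2 _ (Finset.mem_singleton_self _)))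

theorem isDiversePoint_iff {K : Type*} {m : ℕ} {F : Finpartition (Finset.univ : Finset (Fin m))}
    {x : Fin m → K} : IsDiversePoint F x ↔ ∀ j j', x j = x j' → F.part j = F.part j' := by
  constructor
  · intro h j j' hjj'
    have hj := F.mem_part (Finset.mem_univ j)
    by_contra hne
    have hj' : j' ∉ F.part j := fun hm =>
      hne (F.part_eq_of_mem (F.part_mem.2 (Finset.mem_univ j)) hm).symm
    have : x j ∈ {y | ∃ k ∈ F.part j, x k = y} ∩ {y | ∃ k ∉ F.part j, x k = y} :=
      ⟨⟨j, hj, rfl⟩, ⟨j', hj', hjj'.symm⟩⟩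
    rw [h _ (F.part_mem.2 (Finset.mem_univ j))] at this
    exact this
  · intro h P hP
    rw [eq_empty_iff_forall_notMem]
    rintro _ ⟨⟨j, hj, rfl⟩, ⟨j', hj', hjj'⟩⟩
    rw [← F.part_eq_of_mem hP hj, h j j' hjj'.symm] at hj'
    exact hj' (F.mem_part (Finset.mem_univ j'))

/-- An `ω₁`-sequence in a finite power is, on an uncountable set of indices, constant in some
coordinates and countable-to-one in the others. -/
theorem exists_constant_coordinates {K : Type*} {m : ℕ} (x : Omega1 → Fin m → K) :
    ∃ (C : Finset (Fin m)) (c : Fin m → K), ¬ {α | ∀ j ∈ C, x α j = c j}.Countable ∧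
      ∀ j ∉ C, ∀ v, {α | (∀ j ∈ C, x α j = c j) ∧ x α j = v}.Countable := by
  have hunc : ¬ (univ : Set Omega1).Countable := fun h => by
    obtain ⟨γ, hγ⟩ := exists_gt_of_countable h
    exact lt_irrefl _ (hγ γ (mem_univ _))
  have hx0 : Nonempty (Fin m → K) := ⟨x ⟨0, isSuccLimit_omega_one.bot_lt⟩⟩
  obtain ⟨C, ⟨c, hc⟩, hmax⟩ := (Set.toFinite {C : Finset (Fin m) |
    ∃ c : Fin m → K, ¬ {α | ∀ j ∈ C, x α j = c j}.Countable}).exists_maximal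
      ⟨∅, hx0.some, by simpa using hunc⟩
  refine ⟨C, c, hc, fun j hj v => ?_⟩
  by_contra hcon
  refine hj (hmax (y := insert j C) ⟨Function.update c j v, fun h => hcon (h.mono ?_)⟩
    (Finset.subset_insert _ _) (Finset.mem_insert_self _ _))
  rintro α ⟨hα, hv⟩ k hk
  by_cases hkj : k = j
  · subst hkj; simpa using hv
  · rw [Function.update_of_ne hkj]
    exact hα k ((Finset.mem_insert.1 hk).resolve_left hkj)

theorem CapturesFamilies.isDiverse (hcap : CapturesFamilies hR) {K : Type*} [TopologicalSpace K]
    {i : (labelledSystem hR).Pt → K} {a : K} (hi : IsOpenEmbedding i) (hr : range i = {a}ᶜ)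
    (n : ℕ) : IsDiverse K n := by
  classical
  intro m F _ x hx
  simp only [isDiversePoint_iff] at hx ⊢
  obtain ⟨C, c, hc, hC⟩ := exists_constant_coordinates x
  set A : Set Omega1 := {α | ∀ j ∈ C, x α j = c j}
  obtain ⟨α₀, hα₀⟩ : A.Nonempty := nonempty_iff_ne_empty.2 fun h => hc (h ▸ countable_empty)
  by_cases hCu : ∀ j, j ∈ C
  · have hxc : ∀ α ∈ A, x α = c := fun α hα => funext fun j => hα j (hCu j)
    refine ⟨c, hxc α₀ hα₀ ▸ hx α₀, fun U hU => ?_⟩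
    exact fun h => hc (h.countable.mono fun α hα =>
      show x α ∈ U from (hxc α hα).symm ▸ mem_of_mem_nhds hU)
  obtain ⟨j₀, hj₀⟩ := not_forall.1 hCu
  -- the coordinates as points of the ladder system
  have hy : ∀ k : K, ∃ p, k ≠ a → i p = k := fun k => by
    rcases LadderSystem.eq_or_mem_range hr k with rfl | ⟨p, hp⟩
    -- An arbitrary value at `a`: the family used below avoids `a` in the nonconstant coordinates.
    · exact ⟨α₀, fun h => absurd rfl h⟩
    · exact ⟨p, fun _ => hp⟩
  choose pt hpt using hy
  let y : Omega1 → Fin m → Omega1 := fun α j => pt (x α j)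
  let label : Fin m → ℕ := fun j => Encodable.encode (F.part j)
  let t : Omega1 → Finset (Omega1 × ℕ) := fun α =>
    ({j | j ∉ C} : Finset (Fin m)).image fun j => (y α j, label j)
  have hmt : ∀ α p, p ∈ t α ↔ ∃ j, j ∉ C ∧ (y α j, label j) = p := by
    intro α p; simp [t]
  obtain ⟨r, hr₁⟩ := exists_uncountable_bounded hc
    fun α => Finset.univ.sup fun j => rankBound N (y α j)
  obtain ⟨γ₀, hγ₀⟩ := exists_gt_of_countable (Set.finite_range fun j => pt (c j)).countable
  set b : ℕ := Finset.univ.sup label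
  -- The number dominates both the ranks, at most `r`, and the labels, at most `b`. Staying above
  -- `γ₀` keeps the limits `l + k` off the constant coordinates.
  obtain ⟨l, hl, ℬ, hℬ, hinf, hlt, hU⟩ := hcap (max r (b + 1))
    {s | ∃ α ∈ A, (∀ j, rankBound N (y α j) ≤ r) ∧ (∀ j ∉ C, x α j ≠ a) ∧
      (∀ j ∉ C, γ₀ < y α j) ∧ s = t α} (by
      rintro _ ⟨α, hα, hαr, hαa, -, rfl⟩
      refine ⟨⟨_, (hmt α _).2 ⟨j₀, hj₀, rfl⟩⟩, ?_, ?_⟩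
      · intro p hp
        obtain ⟨j, -, rfl⟩ := (hmt α p).1 hp
        exact ⟨lt_max_of_lt_right (Nat.lt_succ_of_le (Finset.le_sup (f := label) (Finset.mem_univ j))),
          (hαr j).trans (le_max_left _ _)⟩
      · intro z k k' hk hk'
        obtain ⟨j, hj, h1⟩ := (hmt α _).1 hk
        obtain ⟨j', hj', h2⟩ := (hmt α _).1 hk'
        rw [Prod.mk.injEq] at h1 h2
        have : x α j = x α j' := by
          rw [← hpt _ (hαa j hj), ← hpt _ (hαa j' hj')]
          exact congrArg i (h1.1.trans h2.1.symm)
        rw [← h1.2, ← h2.2]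
        exact congrArg Encodable.encode (hx α j j' this)) (by
      intro γ
      obtain ⟨α, ⟨hαA, hαr⟩, hα⟩ : ∃ α, (α ∈ A ∧ (Finset.univ.sup fun j => rankBound N (y α j)) ≤ r) ∧
          ∀ j ∉ C, x α j ≠ a ∧ max γ γ₀ < y α j := by
        by_contra! h
        -- Otherwise each index in an uncountable set has a nonconstant coordinate with value in a
        -- fixed countable set, though each value is taken only countably often.
        refine hr₁ (Countable.mono (s₂ := ⋃ (j : Fin m) (_ : j ∉ C),
          ({α | α ∈ A ∧ x α j = a} ∪ ⋃ v ∈ Iic (max γ γ₀), {α | α ∈ A ∧ x α j = i v})) ?_ ?_)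
        · intro α hα
          obtain ⟨j, hj, hle⟩ := h α hα
          refine mem_iUnion₂.2 ⟨j, hj, ?_⟩
          by_cases hxa : x α j = a
          · exact Or.inl ⟨hα.1, hxa⟩
          · exact Or.inr (mem_biUnion (hle hxa) ⟨hα.1, (hpt _ hxa).symm⟩)
        · exact countable_iUnion fun j => countable_iUnion fun hj => (hC j hj a).union
            ((countable_Iic _).biUnion fun v _ => hC j hj (i v))
      refine ⟨t α, ⟨α, hαA, fun j => (Finset.le_sup (f := fun j => rankBound N (y α j))
        (Finset.mem_univ j)).trans hαr, fun j hj => (hα j hj).1,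
        fun j hj => (le_max_right _ _).trans_lt (hα j hj).2, rfl⟩, ?_⟩
      intro p hp
      obtain ⟨j, hj, rfl⟩ := (hmt α p).1 hp
      exact (le_max_left _ _).trans_lt (hα j hj).2)
  have hγl : γ₀ < l := by
    obtain ⟨s, hs⟩ := hinf.nonempty
    obtain ⟨α, -, -, -, hα, rfl⟩ := hℬ hs
    exact (hα j₀ hj₀).trans ((hlt _ hs).2 _ ((hmt α _).2 ⟨j₀, hj₀, rfl⟩))
  have hia : ∀ p, i p ≠ a := fun p => by
    have : i p ∈ ({a}ᶜ : Set K) := hr ▸ mem_range_self p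
    exact this
  have hcl : ∀ j k, c j ≠ i (add l k) := by
    intro j k h
    have h1 : pt (c j) = add l k := hi.injective ((hpt _ (h ▸ hia _)).trans h)
    have h2 := hγ₀ _ (mem_range_self j)
    have h3 : l ≤ add l k := by simpa [Omega1.add_zero] using (add_le_add_iff l 0 k).2 (Nat.zero_le k)
    rw [h1] at h2
    exact lt_asymm h2 (hγl.trans_le h3)
  refine ⟨fun j => if j ∈ C then c j else i (add l (label j)), ?_, ?_⟩
  · intro j j' hjj'
    by_cases hj : j ∈ C <;> by_cases hj' : j' ∈ C
    · simp only [hj, hj', if_true] at hjj'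
      exact hx α₀ j j' (by rw [hα₀ j hj, hα₀ j' hj', hjj'])
    · simp only [hj, hj', if_true, if_false] at hjj'
      exact absurd hjj' (hcl _ _)
    · simp only [hj, hj', if_true, if_false] at hjj'
      exact absurd hjj'.symm (hcl _ _)
    · simp only [hj, hj', if_false] at hjj'
      have h := congrArg fin (hi.injective hjj')
      rw [← hl, fin_lim_add, fin_lim_add] at h
      exact Encodable.encode_injective h
  · intro U hUz
    rw [nhds_pi, Filter.mem_pi'] at hUz
    obtain ⟨I, u, hu, huU⟩ := hUz
    have hfin := hU (fun k => {p | ∀ j, j ∉ C → label j = k → i p ∈ u j}) fun k => by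
      simp only [ofPred_forall]
      refine (Filter.iInter_mem).2 fun j => (Filter.iInter_mem).2 fun hj =>
        (Filter.iInter_mem).2 fun hk => ?_
      subst hk
      have := hu j
      simp only [hj, if_false] at this
      exact hi.continuous.continuousAt this
    refine Infinite.of_image t ((hinf.sdiff hfin).mono ?_)
    rintro s ⟨hs, hsU⟩
    obtain ⟨α, hαA, -, hαa, -, rfl⟩ := hℬ hs
    refine ⟨α, huU fun j _ => ?_, rfl⟩
    by_cases hj : j ∈ C
    · have := mem_of_mem_nhds (hu j)
      simp only [hj, if_true] at this
      rwa [hαA j hj]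
    · by_contra hcon
      refine hsU ⟨hs, _, (hmt α _).2 ⟨j, hj, rfl⟩, fun h => hcon ?_⟩
      have : i (pt (x α j)) ∈ u j := h j hj rfl
      rwa [hpt _ (hαa j hj)] at this

end CapturesFamilies

/-! ### Assembling the space -/

theorem mainTheorem10 (hclub : OstaszewskiClub) :
    ∃ τ : TopologicalSpace (Iic (ω₁ : Ordinal.{0})),
      @T2Space _ τ ∧ @CompactSpace _ τ ∧ @IsScattered _ τ ∧
      ¬ @TopologicalSpace.SeparableSpace _ τ ∧
      @scatteredHeight _ τ = ω + 1 ∧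
      @topWeight _ τ = ℵ₁ ∧
      (∀ n : ℕ, @IsDiverse _ τ n) ∧
      (∀ α < (ω₁ : Ordinal.{0}), ∃ n : ℕ, IsClosed[τ]
        {x : Iic (ω₁ : Ordinal.{0}) | x.1 ≤ α + (n : Ordinal.{0}) ∨ x.1 = ω₁}) ∧
      ∃ φ : Iio (ω₁ : Ordinal.{0}) → Iio (ω₁ : Ordinal.{0}),
        @Continuous _ _
          (TopologicalSpace.induced (inclusion Iio_subset_Iic_self) τ)
          (Preorder.topology (Iio (ω₁ : Ordinal.{0}))) φ ∧
        Function.Surjective φ ∧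
        ∀ β, (φ ⁻¹' {β}).Finite := by
  obtain ⟨R, N, hR, hcap⟩ := hclub.exists_capturesFamilies
  let S := labelledSystem hR
  let i : S.Pt → Iic (ω₁ : Ordinal.{0}) := inclusion Iio_subset_Iic_self
  have hinj : Function.Injective i := inclusion_injective _
  have hr : range i = {⟨ω₁, self_mem_Iic⟩}ᶜ := by
    ext k
    constructor
    · rintro ⟨p, rfl⟩ h
      exact (show p.1 < ω₁ from p.2).ne (congrArg Subtype.val h)
    · intro hk
      exact ⟨⟨k.1, lt_of_le_of_ne k.2 fun h => hk (Subtype.ext h)⟩, rfl⟩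
  obtain ⟨τ, h2, hc, hi⟩ := exists_onePoint_topology hinj hr
  have hsurj : Function.Surjective (collapse N) := fun p => ⟨_, collapse_add p⟩
  have hsep := @LadderSystem.not_separableSpace_onePoint _ _ _ _ S _ i τ hi fun s hs => by
    obtain ⟨γ, hγ⟩ := exists_gt_of_countable hs
    obtain ⟨p, hp⟩ := hsurj γ
    exact ⟨p, fun q hq => ((collapse_le q).trans_lt (hγ q hq)).trans_eq hp.symm⟩
  refine ⟨τ, h2, hc, @LadderSystem.isScattered_onePoint _ _ _ _ S _ i _ τ hi hr, hsep, ?_,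
    @topWeight_onePoint _ _ _ _ _ S τ i _ h2 hc hi hr Omega1.mk_eq.le hsep,
    @CapturesFamilies.isDiverse R N hR hcap _ τ i _ hi hr, ?_, ?_⟩
  · refine @scatteredHeight_onePoint _ _ _ _ _ S τ i _ h2 hc hi hr (rankBound N)
      (fun p x hx => rankBound_lt hR hx) (fun p => ?_) (fun h => ?_)
      fun X hX => hcap.uncountable_accPt hX
    · exact (countable_Iic _).mono fun z hz =>
        (collapse_le_iff _ _).1 (LadderSystem.φ_le_of_mem_V hz)
    · obtain ⟨γ, hγ⟩ := exists_gt_of_countable (s := univ) h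
      exact lt_irrefl _ (hγ γ (mem_univ _))
  · intro α hα
    -- With this `n`, the complement of the set is the open set of points of rank above `α`.
    refine ⟨N (lim ⟨α, hα⟩), ?_⟩
    have ho := hi.isOpenMap _
      (LadderSystem.isOpen_lt_φ (S := S) (⟨α, hα⟩ : Omega1))
    rw [← @isOpen_compl_iff _ _ τ]
    convert ho using 1
    ext k
    constructor
    · intro hk
      simp only [mem_compl_iff, mem_ofPred_eq, not_or] at hk
      refine ⟨⟨k.1, lt_of_le_of_ne k.2 hk.2⟩, ?_, rfl⟩
      exact not_le.1 fun h => hk.1 ((collapse_le_iff _ _).1 h)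
    · rintro ⟨p, hp, rfl⟩ (h | h)
      · exact (show (⟨α, hα⟩ : Omega1) < collapse N p from hp).not_ge ((collapse_le_iff _ _).2 h)
      · exact (show p.1 < ω₁ from p.2).ne h
  · refine ⟨collapse N, ?_, hsurj, finite_collapse_preimage⟩
    have hind := hi.isInducing
    have := @LadderSystem.continuous_φ _ _ _ _ S (Preorder.topology Omega1)
      (@OrderTopology.mk _ (Preorder.topology Omega1) _ rfl)
    rw [hind.eq_induced] at this
    exact this
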